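/- Let $(K,\star)$ be a pointed Kan complex, i.e. a simplicial set $K$ in which every horn has a filler, together with a base point $\star\in K_0$; we also write $\star$ for the unique degenerate simplex on the base point in each dimension, and for the subcomplex formed by these simplices. Write $d_i$ and $s_i$ for the face and degeneracy operators and $\partial x=(d_0x,\dots,d_mx)$ for $x\in K_m$. For $n\ge 1$ let $\pi_n(K,\star)$ be the set of $n$-simplices $x\in K_n$ with $\partial x=(\star,\dots,\star)$, modulo the homotopy relation: $x\sim y$ iff there is $h\in K_{n+1}$ with $\partial h=(s_{n-1}d_0x,\dots,s_{n-1}d_{n-1}x,x,y)$. It is a group under $[x]_\pi[y]_\pi=[z]_\pi$ whenever some $h\in K_{n+1}$ has $\partial h=(\star,\dots,\star,y,z,x)$. Let $H_n(K,\star)=H_n(K,\star;\mathbb{Z})$ be the $n$-th homology group of the chain complex $C_m=\mathbb{Z}[K_m]/\mathbb{Z}[\star_m]$, where $\star_m$ is the simplex $\star$ of dimension $m$, with differential $\mathbf{d}(x)=\sum_{i=0}^m(-1)^i(d_ix)$ for $x\in K_m$. The assignment $[x]_\pi\mapsto[x]_H$ is a well-defined group homomorphism $\varphi:\pi_n(K,\star)\to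 H_n(K,\star)$, the Hurewicz homomorphism. Suppose that $n\ge 1$ and $K_{n-1}=\{\star\}$. - If $n\ge 2$, then $\varphi:\pi_n(K,\star)\to H_n(K,\star)$ is an isomorphism of groups. - If $n=1$, then the homomorphism $\pi_1(K,\star)^{\mathrm{ab}}\to H_1(K,\star)$ induced by $\varphi$ on the abelianization of $\pi_1(K,\star)$ is an isomorphism. -/

import Mathlib

open CategoryTheory Simplicial Opposite

universe u

namespace KanHurewicz

variable (X : SSet.{u})

/-- The degenerate `n`-simplex `⋆ₙ` on the base point `pt`. -/
def starSimplex (pt : X _⦋0⦌) (n : ℕ) : X _⦋n⦌ :=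
  X.map (SimplexCategory.const ⦋n⦌ ⦋0⦌ 0).op pt

variable {X}

/-- All faces of the `n`-simplex `x` are equal to the base point
(no condition when `n = 0`). -/
def IsSpherical (pt : X _⦋0⦌) (n : ℕ) (x : X _⦋n⦌) : Prop :=
  match n, x with
  | 0, _ => True
  | n + 1, x => ∀ i : Fin (n + 2), X.δ i x = starSimplex X pt n

/-- Two `n`-simplices with the same boundary are homotopic when
`(sₙ₋₁ d₀ x, …, sₙ₋₁ dₙ₋₁ x, x, y)` is the boundary of some `(n + 1)`-simplex `h`. -/
def Homotopic (n : ℕ) (x y : X _⦋n⦌) : Prop :=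
  match n, x, y with
  | 0, x, y => ∃ h : X _⦋1⦌, X.δ 0 h = x ∧ X.δ 1 h = y
  | n + 1, x, y => (∀ i : Fin (n + 2), X.δ i x = X.δ i y) ∧
      ∃ h : X _⦋n + 2⦌,
        (∀ i : Fin (n + 1), X.δ i.castSucc.castSucc h = X.σ (Fin.last n) (X.δ i.castSucc x)) ∧
        X.δ (Fin.last (n + 1)).castSucc h = x ∧ X.δ (Fin.last (n + 2)) h = y

variable (X) in
/-- The underlying set of `πₙ(X, pt)`: homotopy classes of the `n`-simplices whose boundary
is `(⋆, …, ⋆)`. -/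
def HomotopyGroup (pt : X _⦋0⦌) (n : ℕ) : Type u :=
  Quot fun x y : {x : X _⦋n⦌ // IsSpherical pt n x} => Homotopic n x.1 y.1

/-- The class `[x]` in the homotopy group. -/
def HomotopyGroup.mk {pt : X _⦋0⦌} {n : ℕ} (x : X _⦋n⦌) (hx : IsSpherical pt n x) :
    HomotopyGroup X pt n :=
  Quot.mk _ ⟨x, hx⟩

/-- `(⋆, …, ⋆, y, z, x)` is the boundary of some simplex: `z` is a product `xy`. -/
def IsProduct (pt : X _⦋0⦌) {n : ℕ} (x y z : X _⦋n + 1⦌) : Prop :=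
  ∃ h : X _⦋n + 2⦌,
    (∀ i : Fin n, X.δ i.castSucc.castSucc.castSucc h = starSimplex X pt (n + 1)) ∧
    X.δ (Fin.last n).castSucc.castSucc h = y ∧
    X.δ (Fin.last (n + 1)).castSucc h = z ∧
    X.δ (Fin.last (n + 2)) h = x

section GroupLaws

variable {pt : X _⦋0⦌} {n : ℕ}

lemma δ_star (m : ℕ) (i : Fin (m + 2)) : X.δ i (starSimplex X pt (m + 1)) = starSimplex X pt m := by
  simp only [starSimplex, SimplicialObject.δ, ← Functor.map_comp_apply, ← op_comp]
  rfl

lemma σ_star (m : ℕ) (i : Fin (m + 1)) : X.σ i (starSimplex X pt m) = starSimplex X pt (m + 1) := by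
  simp only [starSimplex, SimplicialObject.σ, ← Functor.map_comp_apply, ← op_comp]
  rfl

lemma isSpherical_star (m : ℕ) : IsSpherical pt (m + 1) (starSimplex X pt (m + 1)) := δ_star m

/-- The horn filling condition in terms of simplices. -/
lemma exists_filler [SSet.KanComplex X] {m : ℕ} (k : Fin (m + 3))
    (f : Fin (m + 3) → X _⦋m + 1⦌)
    (hf : ∀ (i j : Fin (m + 3)) (hij : i < j), i ≠ k → j ≠ k →
      X.δ (j.pred (Fin.ne_zero_of_lt hij)) (f i) =
        X.δ (i.castPred (Fin.ne_last_of_lt hij)) (f j)) :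
    ∃ h : X _⦋m + 2⦌, ∀ i, i ≠ k → X.δ i h = f i := by
  have hc : SSet.horn.IsCompatible (i := k)
      (fun (j : Fin (m + 3)) (_ : j ≠ k) => SSet.yonedaEquiv.symm (f j)) := by
    rw [SSet.horn.isCompatible_iff]
    intro i j hi hj hij
    rw [SSet.stdSimplex.δ_comp_yonedaEquiv_symm, SSet.stdSimplex.δ_comp_yonedaEquiv_symm,
      hf i j hij hi hj]
  obtain ⟨φ, hφ⟩ := hc.exists_lift_of_kanComplex
  refine ⟨SSet.yonedaEquiv φ, fun i hi => ?_⟩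
  rw [← SSet.stdSimplex.yonedaEquiv_δ_comp, hφ i hi, Equiv.apply_symm_apply]

/-- If, in a compatible family of cycles, all but one are boundaries, then so is the last one. -/
lemma matrix_lemma [SSet.KanComplex X] {m : ℕ} (N : Fin (m + 4) → Fin (m + 4) → X _⦋m + 1⦌)
    (hN : ∀ i j, N i j = N j i) (k : Fin (m + 4))
    (hk : ∀ i, i ≠ k → ∃ h : X _⦋m + 2⦌, ∀ j, X.δ j h = N i (i.succAbove j)) :
    ∃ h : X _⦋m + 2⦌, ∀ j, X.δ j h = N k (k.succAbove j) := by
  have : Nonempty (X _⦋m + 2⦌) := ⟨(hk _ (exists_ne k).choose_spec).choose⟩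
  choose! f hf using hk
  obtain ⟨H, hH⟩ := exists_filler k f (by
    intro i j hij hi hj
    rw [hf i hi, hf j hj, hN j]
    rw [Fin.succAbove_pred_of_lt _ _ hij, Fin.succAbove_castPred_of_lt _ _ hij, hN])
  refine ⟨X.δ k H, fun j => ?_⟩
  rcases lt_or_ge j.castSucc k with hlt | hle
  · obtain ⟨k, rfl⟩ := k.eq_succ_of_ne_zero (Fin.ne_zero_of_lt hlt)
    have hjk : j ≤ k := Fin.castSucc_lt_succ_iff.mp hlt
    rw [SSet.δ_comp_δ_apply hjk, hH _ hlt.ne, hf _ hlt.ne,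
      Fin.succAbove_of_castSucc_lt _ _ hlt, hN,
      Fin.succAbove_of_le_castSucc _ _ (Fin.castSucc_le_castSucc_iff.mpr hjk)]
  · obtain ⟨k, rfl⟩ := k.eq_castSucc_of_ne_last (Fin.ne_last_of_lt
      (lt_of_le_of_lt hle j.castSucc_lt_last))
    have hkj : k ≤ j := Fin.castSucc_le_castSucc_iff.mp hle
    have hne : j.succ ≠ k.castSucc := (Fin.castSucc_lt_succ_iff.mpr hkj).ne'
    rw [← SSet.δ_comp_δ_apply hkj, hH _ hne, hf _ hne,
      Fin.succAbove_of_le_castSucc _ _ hle, hN,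
      Fin.succAbove_of_castSucc_lt _ _ (Fin.castSucc_lt_succ_iff.mpr hkj)]

/-- The tuple `(⋆, …, ⋆, p, q, r)`. -/
def tuple (pt : X _⦋0⦌) (n : ℕ) (p q r : X _⦋n + 1⦌) (j : ℕ) : X _⦋n + 1⦌ :=
  if j < n then starSimplex X pt (n + 1) else if j = n then p else if j = n + 1 then q else r

lemma isProduct_iff (p q r : X _⦋n + 1⦌) : IsProduct pt r p q ↔
    ∃ h : X _⦋n + 2⦌, ∀ j : Fin (n + 3), X.δ j h = tuple pt n p q r j := by
  refine exists_congr fun h => ⟨?_, fun H => ⟨fun i => ?_, ?_, ?_, ?_⟩⟩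
  · rintro ⟨h0, h1, h2, h3⟩ j
    by_cases hj : j.val < n
    · rw [tuple, if_pos hj, ← h0 ⟨j, hj⟩]; rfl
    · by_cases hj1 : j.val = n
      · rw [tuple, if_neg hj, if_pos hj1, ← h1, show j = (Fin.last n).castSucc.castSucc from Fin.ext hj1]
      · by_cases hj2 : j.val = n + 1
        · rw [tuple, if_neg hj, if_neg hj1, if_pos hj2, ← h2, show j = (Fin.last (n + 1)).castSucc from Fin.ext hj2]
        · rw [tuple, if_neg hj, if_neg hj1, if_neg hj2, ← h3,
            show j = Fin.last (n + 2) from Fin.ext (by simp only [Fin.val_last]; omega)]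
  · simp [H, tuple]
  · simp [H, tuple]
  · simp [H, tuple]
  · simp [H, tuple]

/-- The symmetric matrix of codimension two faces of a simplex whose nontrivial codimension two
faces omit two of the last four vertices. -/
def entry (pt : X _⦋0⦌) (n : ℕ) (ab ac ad bc bd cd : X _⦋n + 1⦌) (i j : ℕ) : X _⦋n + 1⦌ :=
  if min i j < n then starSimplex X pt (n + 1)
  else if min i j = n then
    (if max i j = n + 1 then ab else if max i j = n + 2 then ac else ad)
  else if min i j = n + 1 then (if max i j = n + 2 then bc else bd)
  else cd

lemma succAbove_val {m : ℕ} (k : Fin (m + 1)) (j : Fin m) :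
    (k.succAbove j).val = if j.val < k.val then j.val else j.val + 1 := by
  rw [Fin.succAbove]; split_ifs <;> simp_all [Fin.lt_def]

lemma entry_column (ab ac ad bc bd cd : X _⦋n + 1⦌) (k : Fin (n + 4)) (j : Fin (n + 3)) :
    entry pt n ab ac ad bc bd cd k (k.succAbove j) =
      if k.val < n then starSimplex X pt (n + 1)
      else if k.val = n then tuple pt n ab ac ad j
      else if k.val = n + 1 then tuple pt n ab bc bd j
      else if k.val = n + 2 then tuple pt n ac bc cd j
      else tuple pt n ad bd cd j := by
  rw [entry, succAbove_val]
  simp only [tuple]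
  grind

/-- In a tetrahedron of products, three of the four faces imply the remaining one. -/
lemma tetra [SSet.KanComplex X] (ab ac ad bc bd cd : X _⦋n + 1⦌) (k : Fin 4)
    (hA : k ≠ 0 → IsProduct pt ad ab ac) (hB : k ≠ 1 → IsProduct pt bd ab bc)
    (hC : k ≠ 2 → IsProduct pt cd ac bc) (hD : k ≠ 3 → IsProduct pt cd ad bd) :
    (k = 0 → IsProduct pt ad ab ac) ∧ (k = 1 → IsProduct pt bd ab bc) ∧
      (k = 2 → IsProduct pt cd ac bc) ∧ (k = 3 → IsProduct pt cd ad bd) := by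
  simp only [isProduct_iff] at *
  have key := matrix_lemma
    (fun i j : Fin (n + 4) => entry pt n ab ac ad bc bd cd i j)
    (fun i j => by simp only [entry, min_comm, max_comm]) (k.natAdd n) (by
      intro i hi
      simp only [entry_column]
      by_cases h0 : i.val < n
      · exact ⟨starSimplex X pt _, fun j => by simp [h0, δ_star]⟩
      · obtain ⟨l, rfl⟩ : ∃ l : Fin 4, i = l.natAdd n :=
          ⟨⟨i.val - n, by omega⟩, Fin.ext (by simp; omega)⟩
        have hl : k ≠ l := fun h => hi (by rw [h])
        fin_cases l
        · simpa using hA hl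
        · simpa using hB hl
        · simpa using hC hl
        · simpa using hD hl)
  simp only [entry_column] at key
  refine ⟨?_, ?_, ?_, ?_⟩ <;> rintro rfl <;> simpa using key

lemma δ_σ_of_isSpherical {x : X _⦋n + 1⦌} (hx : IsSpherical pt (n + 1) x) (i : Fin (n + 3))
    (j : Fin (n + 2)) (h1 : i ≠ j.castSucc) (h2 : i ≠ j.succ) :
    X.δ i (X.σ j x) = starSimplex X pt (n + 1) := by
  rcases lt_or_gt_of_ne h1 with h | h
  · obtain ⟨i, rfl⟩ := i.eq_castSucc_of_ne_last (Fin.ne_last_of_lt h)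
    have h' : i < j := h
    obtain ⟨j, rfl⟩ := j.eq_succ_of_ne_zero (Fin.ne_zero_of_lt h')
    rw [SSet.δ_comp_σ_of_le_apply (Fin.le_castSucc_iff.mpr h'), hx, σ_star]
  · have h' : j.succ < i := lt_of_le_of_ne (Fin.castSucc_lt_iff_succ_le.mp h) h2.symm
    rw [SSet.δ_comp_σ_of_gt'_apply h', hx, σ_star]

lemma isProduct_star_left (x : X _⦋n + 1⦌) (hx : IsSpherical pt (n + 1) x) :
    IsProduct pt (starSimplex X pt (n + 1)) x x := by
  refine ⟨X.σ (Fin.last n).castSucc x, fun i => ?_, ?_, ?_, ?_⟩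
  · exact δ_σ_of_isSpherical hx _ _ (by simp [Fin.ext_iff]; omega) (by simp [Fin.ext_iff]; omega)
  · exact SSet.δ_comp_σ_self_apply _ _
  · exact SSet.δ_comp_σ_succ_apply (Fin.last n).castSucc _
  · exact δ_σ_of_isSpherical hx _ _ (by simp [Fin.ext_iff]) (by simp [Fin.ext_iff])

lemma isProduct_star_right (x : X _⦋n + 1⦌) (hx : IsSpherical pt (n + 1) x) :
    IsProduct pt x (starSimplex X pt (n + 1)) x := by
  refine ⟨X.σ (Fin.last (n + 1)) x, fun i => ?_, ?_, ?_, ?_⟩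
  · exact δ_σ_of_isSpherical hx _ _ (by simp [Fin.ext_iff]; omega) (by simp [Fin.ext_iff]; omega)
  · exact δ_σ_of_isSpherical hx _ _ (by simp [Fin.ext_iff]) (by simp [Fin.ext_iff]; omega)
  · exact SSet.δ_comp_σ_self_apply _ _
  · exact SSet.δ_comp_σ_succ_apply (Fin.last (n + 1)) _

/-- Homotopy of spherical simplices as a product relation. -/
lemma homotopic_iff {x y : X _⦋n + 1⦌} (hx : IsSpherical pt (n + 1) x)
    (hy : IsSpherical pt (n + 1) y) :
    Homotopic (n + 1) x y ↔ IsProduct pt y (starSimplex X pt (n + 1)) x := by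
  simp only [IsSpherical] at hx hy
  simp only [Homotopic, IsProduct, hx, hy, σ_star, implies_true, true_and]
  refine exists_congr fun h => ?_
  rw [Fin.forall_fin_succ']
  tauto

lemma exists_δ_δ_eq {m : ℕ} (h : X _⦋m + 2⦌) (k : Fin (m + 3)) (j : Fin (m + 2)) :
    ∃ (a : Fin (m + 3)) (b : Fin (m + 2)), a ≠ k ∧ X.δ j (X.δ k h) = X.δ b (X.δ a h) := by
  rcases lt_or_ge j.castSucc k with hlt | hle
  · obtain ⟨k, rfl⟩ := k.eq_succ_of_ne_zero (Fin.ne_zero_of_lt hlt)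
    exact ⟨_, _, hlt.ne, SSet.δ_comp_δ_apply (Fin.castSucc_lt_succ_iff.mp hlt) h⟩
  · obtain ⟨k, rfl⟩ := k.eq_castSucc_of_ne_last (Fin.ne_last_of_lt
      (lt_of_le_of_lt hle j.castSucc_lt_last))
    have hkj : k ≤ j := Fin.castSucc_le_castSucc_iff.mp hle
    exact ⟨_, _, (Fin.castSucc_lt_succ_iff.mpr hkj).ne', (SSet.δ_comp_δ_apply hkj h).symm⟩

/-- Completion of `(⋆, …, ⋆, y, ?, x)` and of its variants. -/
lemma exists_completion [SSet.KanComplex X] (k : Fin 3) (p q r : X _⦋n + 1⦌)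
    (hp : IsSpherical pt (n + 1) p) (hq : IsSpherical pt (n + 1) q)
    (hr : IsSpherical pt (n + 1) r) :
    ∃ s, IsSpherical pt (n + 1) s ∧ IsProduct pt (if k = 2 then s else r)
      (if k = 0 then s else p) (if k = 1 then s else q) := by
  have ht (j : ℕ) : IsSpherical pt (n + 1) (tuple pt n p q r j) := by
    rw [tuple]
    split_ifs <;> first | assumption | exact isSpherical_star n
  obtain ⟨h, hh⟩ := exists_filler (k.natAdd n : Fin (n + 3)) (fun j => tuple pt n p q r j)
    (fun i j hij _ _ => by rw [ht i _, ht j _])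
  refine ⟨X.δ (k.natAdd n : Fin (n + 3)) h, fun i => ?_, (isProduct_iff ..).2 ⟨h, fun j => ?_⟩⟩
  · obtain ⟨a, b, ha, hab⟩ := exists_δ_δ_eq h (k.natAdd n : Fin (n + 3)) i
    rw [hab, hh a ha, ht a b]
  · by_cases hj : j = k.natAdd n
    · subst hj
      fin_cases k <;> simp [tuple]
    · rw [hh j hj]
      fin_cases k <;> simp [tuple] <;> grind

section

variable {x y z p p' q q' r r' : X _⦋n + 1⦌}

lemma star_star : IsProduct pt (starSimplex X pt (n + 1)) (starSimplex X pt (n + 1)) (starSimplex X pt (n + 1)) := isProduct_star_left _ (isSpherical_star n)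

variable [SSet.KanComplex X]

lemma rel_euclid (h1 : IsProduct pt y (starSimplex X pt (n + 1)) x) (h2 : IsProduct pt z (starSimplex X pt (n + 1)) x) :
    IsProduct pt z (starSimplex X pt (n + 1)) y :=
  (tetra (starSimplex X pt (n + 1)) (starSimplex X pt (n + 1)) (starSimplex X pt (n + 1)) x y z 3 (fun _ => star_star) (fun _ => h1) (fun _ => h2)
    (fun h => absurd rfl h)).2.2.2 rfl

lemma rel_symm (hx : IsSpherical pt (n + 1) x) (h1 : IsProduct pt y (starSimplex X pt (n + 1)) x) :
    IsProduct pt x (starSimplex X pt (n + 1)) y :=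
  rel_euclid h1 (isProduct_star_right _ hx)

lemma congr_fst (hp : IsProduct pt p' (starSimplex X pt (n + 1)) p) (hq : IsSpherical pt (n + 1) q)
    (h : IsProduct pt r p q) : IsProduct pt r p' q :=
  (tetra (starSimplex X pt (n + 1)) p p' q q r 3 (fun _ => hp) (fun _ => isProduct_star_right _ hq) (fun _ => h)
    (fun h => absurd rfl h)).2.2.2 rfl

lemma congr_snd (hp : IsSpherical pt (n + 1) p) (hq : IsProduct pt q' (starSimplex X pt (n + 1)) q)
    (h : IsProduct pt r p q) : IsProduct pt r p q' :=
  (tetra (starSimplex X pt (n + 1)) p p q q' r 3 (fun _ => isProduct_star_right _ hp) (fun _ => hq) (fun _ => h)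
    (fun h => absurd rfl h)).2.2.2 rfl

lemma snd_unique (hp : IsSpherical pt (n + 1) p)
    (h : IsProduct pt r p q) (h' : IsProduct pt r p q') : IsProduct pt q' (starSimplex X pt (n + 1)) q :=
  (tetra (starSimplex X pt (n + 1)) p p q q' r 1 (fun _ => isProduct_star_right _ hp) (fun h => absurd rfl h)
    (fun _ => h) (fun _ => h')).2.1 rfl

lemma rel_iff_star_left (hx : IsSpherical pt (n + 1) x) :
    IsProduct pt (starSimplex X pt (n + 1)) x y ↔ IsProduct pt y (starSimplex X pt (n + 1)) x := by
  constructor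
  · intro h
    exact (tetra (starSimplex X pt (n + 1)) x x x y (starSimplex X pt (n + 1)) 1 (fun _ => isProduct_star_right _ hx) (fun h => absurd rfl h)
      (fun _ => isProduct_star_left _ hx) (fun _ => h)).2.1 rfl
  · intro h
    exact (tetra (starSimplex X pt (n + 1)) x x x y (starSimplex X pt (n + 1)) 3 (fun _ => isProduct_star_right _ hx) (fun _ => h)
      (fun _ => isProduct_star_left _ hx) (fun h => absurd rfl h)).2.2.2 rfl

lemma congr_thd (hq : IsSpherical pt (n + 1) q) (hr : IsSpherical pt (n + 1) r)
    (hr' : IsSpherical pt (n + 1) r')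
    (hrr : IsProduct pt r' (starSimplex X pt (n + 1)) r) (h : IsProduct pt r p q) : IsProduct pt r' p q :=
  (tetra p q r' q r (starSimplex X pt (n + 1)) 0 (fun h => absurd rfl h) (fun _ => h)
    (fun _ => isProduct_star_left _ hq)
    (fun _ => (rel_iff_star_left hr').2 (rel_symm hr hrr))).1 rfl

end

namespace HomotopyGroup

lemma mk_eq_mk {x y : X _⦋n + 1⦌} (hx : IsSpherical pt (n + 1) x) (hy : IsSpherical pt (n + 1) y)
    (h : IsProduct pt y (starSimplex X pt (n + 1)) x) :
    HomotopyGroup.mk x hx = HomotopyGroup.mk y hy :=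
  Quot.sound ((homotopic_iff hx hy).2 h)

variable [SSet.KanComplex X]

lemma exists_mul (x y : {x : X _⦋n + 1⦌ // IsSpherical pt (n + 1) x}) :
    ∃ z : {x : X _⦋n + 1⦌ // IsSpherical pt (n + 1) x}, IsProduct pt x.1 y.1 z.1 := by
  obtain ⟨z, hz, h⟩ := exists_completion 1 y.1 y.1 x.1 y.2 y.2 x.2
  exact ⟨⟨z, hz⟩, by simpa using h⟩

lemma exists_inv (x : {x : X _⦋n + 1⦌ // IsSpherical pt (n + 1) x}) :
    ∃ y : {x : X _⦋n + 1⦌ // IsSpherical pt (n + 1) x},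
      IsProduct pt y.1 x.1 (starSimplex X pt (n + 1)) := by
  obtain ⟨z, hz, h⟩ := exists_completion 2 x.1 (starSimplex X pt (n + 1)) x.1 x.2 (isSpherical_star n) x.2
  exact ⟨⟨z, hz⟩, by simpa using h⟩

/-- `[x][y] = [xy]`, where `xy` completes the horn `(⋆, …, ⋆, y, ?, x)`. -/
noncomputable instance : Mul (HomotopyGroup X pt (n + 1)) where
  mul := Quot.lift₂ (fun x y => Quot.mk _ (exists_mul x y).choose)
    (fun x y y' h => by
      rw [homotopic_iff y.2 y'.2] at h
      exact mk_eq_mk _ _ (snd_unique y'.2 (congr_fst h (exists_mul x y).choose.2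
        (exists_mul x y).choose_spec) (exists_mul x y').choose_spec))
    (fun x x' y h => by
      rw [homotopic_iff x.2 x'.2] at h
      exact mk_eq_mk _ _ (snd_unique y.2 (congr_thd (exists_mul x y).choose.2 x.2 x'.2 h
        (exists_mul x y).choose_spec) (exists_mul x' y).choose_spec))

lemma mk_mul_mk {x y z : X _⦋n + 1⦌} (hx : IsSpherical pt (n + 1) x)
    (hy : IsSpherical pt (n + 1) y) (hz : IsSpherical pt (n + 1) z) (h : IsProduct pt x y z) :
    HomotopyGroup.mk x hx * HomotopyGroup.mk y hy = HomotopyGroup.mk z hz :=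
  mk_eq_mk _ _ (snd_unique hy (exists_mul ⟨x, hx⟩ ⟨y, hy⟩).choose_spec h)

instance : One (HomotopyGroup X pt (n + 1)) where
  one := HomotopyGroup.mk (starSimplex X pt (n + 1)) (isSpherical_star n)

lemma exists_inv_mul (a : HomotopyGroup X pt (n + 1)) :
    ∃ b : HomotopyGroup X pt (n + 1), b * a = 1 := by
  obtain ⟨x, hx⟩ := a
  obtain ⟨z, hz, h⟩ := exists_completion 2 x (starSimplex X pt (n + 1)) x hx (isSpherical_star n) hx
  exact ⟨HomotopyGroup.mk z hz, mk_mul_mk hz hx (isSpherical_star n) (by simpa using h)⟩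

noncomputable instance : Inv (HomotopyGroup X pt (n + 1)) where
  inv a := (exists_inv_mul a).choose

/-- The group structure on `πₙ(X, pt)` in positive degrees. -/
noncomputable instance : Group (HomotopyGroup X pt (n + 1)) where
  mul_assoc := by
    rintro ⟨x, hx⟩ ⟨y, hy⟩ ⟨z, hz⟩
    obtain ⟨⟨xy, hxy⟩, h1⟩ := exists_mul ⟨x, hx⟩ ⟨y, hy⟩
    obtain ⟨⟨xyz, hxyz⟩, h2⟩ := exists_mul ⟨xy, hxy⟩ ⟨z, hz⟩
    obtain ⟨⟨yz, hyz⟩, h3⟩ := exists_mul ⟨y, hy⟩ ⟨z, hz⟩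
    have h4 : IsProduct pt x yz xyz := (tetra z yz y xyz xy x 2 (fun _ => h3) (fun _ => h2)
      (fun h => absurd rfl h) (fun _ => h1)).2.2.1 rfl
    change mk x hx * mk y hy * mk z hz = mk x hx * (mk y hy * mk z hz)
    rw [mk_mul_mk hx hy hxy h1, mk_mul_mk hxy hz hxyz h2, mk_mul_mk hy hz hyz h3,
      mk_mul_mk hx hyz hxyz h4]
  one_mul := by
    rintro ⟨x, hx⟩
    exact mk_mul_mk (isSpherical_star n) hx hx (isProduct_star_left x hx)
  mul_one := by
    rintro ⟨x, hx⟩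
    exact mk_mul_mk hx (isSpherical_star n) hx (isProduct_star_right x hx)
  inv_mul_cancel a := (exists_inv_mul a).choose_spec

end HomotopyGroup

end GroupLaws

section Homology

variable (L : X.Subcomplex)

/-- The group `Cₙ(X, L) = (Xₙ ⊗ ℤ) / (Lₙ ⊗ ℤ)` of simplicial chains of the pair `(X, L)`. -/
abbrev Chains (n : ℕ) : Type u :=
  (X _⦋n⦌ →₀ ℤ) ⧸ Finsupp.supported ℤ ℤ (L.obj (op ⦋n⦌))

/-- The differential `d (x) = ∑ᵢ (-1)ⁱ (dᵢ x)` on the free abelian groups on the simplices. -/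
noncomputable def freeDifferential (X : SSet.{u}) (n : ℕ) :
    (X _⦋n + 1⦌ →₀ ℤ) →ₗ[ℤ] (X _⦋n⦌ →₀ ℤ) :=
  ∑ i : Fin (n + 2), (-1 : ℤ) ^ (i : ℕ) • Finsupp.lmapDomain ℤ ℤ (fun x => X.δ i x)

lemma freeDifferential_single (n : ℕ) (x : X _⦋n + 1⦌) (a : ℤ) :
    freeDifferential X n (Finsupp.single x a) =
      ∑ i : Fin (n + 2), (-1 : ℤ) ^ (i : ℕ) • Finsupp.single (X.δ i x) a := by
  simp [freeDifferential]

lemma supported_le_comap (n : ℕ) :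
    Finsupp.supported ℤ ℤ (L.obj (op ⦋n + 1⦌)) ≤
      (Finsupp.supported ℤ ℤ (L.obj (op ⦋n⦌))).comap (freeDifferential X n) := by
  rw [Finsupp.supported_eq_span_single, Submodule.span_le]
  rintro _ ⟨x, hx, rfl⟩
  simp only [Submodule.comap_coe, Set.mem_preimage, SetLike.mem_coe, freeDifferential_single]
  exact Submodule.sum_mem _ fun i _ => Submodule.smul_mem _ _
    (Finsupp.single_mem_supported ℤ _ (L.map (SimplexCategory.δ i).op hx))

/-- The differential `Cₙ₊₁(X, L) → Cₙ(X, L)`. -/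
noncomputable def differential (n : ℕ) : Chains L (n + 1) →ₗ[ℤ] Chains L n :=
  Submodule.mapQ _ _ (freeDifferential X n) (supported_le_comap L n)

/-- The cycles `Zₙ(X, L)`; every `0`-chain is a cycle. -/
noncomputable def cycles (n : ℕ) : Submodule ℤ (Chains L n) :=
  match n with
  | 0 => ⊤
  | n + 1 => LinearMap.ker (differential L n)

/-- The boundaries `Bₙ(X, L)`. -/
noncomputable def boundaries (n : ℕ) : Submodule ℤ (Chains L n) :=
  LinearMap.range (differential L n)

lemma freeDifferential_comp (n : ℕ) :
    freeDifferential X n ∘ₗ freeDifferential X (n + 1) = 0 := by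
  let F : Type u ⥤ ModuleCat.{u} ℤ :=
    { obj := fun S => ModuleCat.of ℤ (S →₀ ℤ)
      map := fun f => ModuleCat.ofHom (Finsupp.lmapDomain ℤ ℤ fun x => f x)
      map_id := fun S => by ext; simp
      map_comp := fun f g => by ext; simp }
  have h := congrArg ModuleCat.Hom.hom (AlgebraicTopology.AlternatingFaceMapComplex.d_squared
    (((SimplicialObject.whiskering _ _).obj F).obj X) n)
  have e (m : ℕ) : (AlgebraicTopology.AlternatingFaceMapComplex.objD
      (((SimplicialObject.whiskering _ _).obj F).obj X) m).hom =
      freeDifferential X m := by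
    simp only [AlgebraicTopology.AlternatingFaceMapComplex.objD, freeDifferential,
      ModuleCat.hom_sum, ModuleCat.hom_zsmul]
    rfl
  rw [ModuleCat.hom_comp, e, e] at h
  exact h

/-- `Bₙ ⊆ Zₙ`. -/
lemma boundaries_le_cycles (n : ℕ) : boundaries L n ≤ cycles L n := by
  cases n with
  | zero => exact le_top
  | succ n =>
    rintro _ ⟨c, rfl⟩
    obtain ⟨c, rfl⟩ := Submodule.Quotient.mk_surjective _ c
    have h := LinearMap.congr_fun (freeDifferential_comp (X := X) n) c
    simp only [LinearMap.comp_apply, LinearMap.zero_apply] at h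
    simp [cycles, differential, Submodule.mapQ_apply, h]

/-- The simplicial homology `Hₙ(X, L) = Zₙ(X, L) / Bₙ(X, L)` with integral coefficients. -/
abbrev Homology (n : ℕ) : Type u :=
  cycles L n ⧸ (boundaries L n).submoduleOf (cycles L n)

/-- The class in `Cₙ(X, L)` of a simplex. -/
noncomputable def chain (n : ℕ) (x : X _⦋n⦌) : Chains L n :=
  Submodule.Quotient.mk (Finsupp.single x 1)

lemma differential_chain (n : ℕ) (x : X _⦋n + 1⦌) :
    differential L n (chain L (n + 1) x) =
      ∑ i : Fin (n + 2), (-1 : ℤ) ^ (i : ℕ) • chain L n (X.δ i x) := by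
  rw [chain, differential, Submodule.mapQ_apply, freeDifferential_single]
  simp only [chain, ← Submodule.mkQ_apply, map_sum, map_smul]

lemma chain_eq_zero (n : ℕ) (x : X _⦋n⦌) (hx : x ∈ L.obj (op ⦋n⦌)) : chain L n x = 0 :=
  (Submodule.Quotient.mk_eq_zero _).2 (Finsupp.single_mem_supported ℤ _ hx)

variable (pt : X _⦋0⦌) {n : ℕ}

/-- The subcomplex `⋆` of `X` generated by the base point. -/
abbrev basePoint : X.Subcomplex := SSet.Subcomplex.ofSimplex pt

lemma star_mem (n : ℕ) : starSimplex X pt n ∈ (basePoint pt).obj (op ⦋n⦌) :=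
  (SSet.Subcomplex.mem_ofSimplex_obj_iff _ _).2 ⟨_, rfl⟩

lemma chain_star (n : ℕ) : chain (basePoint pt) n (starSimplex X pt n) = 0 :=
  chain_eq_zero _ _ _ (star_mem pt n)

variable {pt}

lemma chain_mem_cycles {n : ℕ} {x : X _⦋n⦌} (hx : IsSpherical pt n x) :
    chain (basePoint pt) n x ∈ cycles (basePoint pt) n := by
  cases n with
  | zero => exact Submodule.mem_top
  | succ n =>
    simp only [IsSpherical] at hx
    simp [cycles, differential_chain, hx, chain_star]

/-- The homology class `[x]` in `Hₙ(X, ⋆)` of a simplex with boundary `(⋆, …, ⋆)`. -/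
noncomputable def homologyClass {n : ℕ} (x : X _⦋n⦌) (hx : IsSpherical pt n x) :
    Homology (basePoint pt) n :=
  Submodule.Quotient.mk ⟨chain (basePoint pt) n x, chain_mem_cycles hx⟩

lemma homologyClass_add {n : ℕ} {x y z : X _⦋n + 1⦌} (hx : IsSpherical pt (n + 1) x)
    (hy : IsSpherical pt (n + 1) y) (hz : IsSpherical pt (n + 1) z) (h : IsProduct pt x y z) :
    homologyClass z hz = homologyClass x hx + homologyClass y hy := by
  obtain ⟨h, h0, h1, h2, h3⟩ := h
  have key : differential (basePoint pt) (n + 1) (chain (basePoint pt) (n + 2) h) =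
      (-1) ^ n • (chain (basePoint pt) (n + 1) y - chain (basePoint pt) (n + 1) z +
        chain (basePoint pt) (n + 1) x) := by
    rw [differential_chain, Fin.sum_univ_castSucc, Fin.sum_univ_castSucc, Fin.sum_univ_castSucc]
    simp only [h0, chain_star, h1, h2, h3]
    simp [pow_succ]
    module
  rw [← sub_eq_zero]
  refine (Submodule.Quotient.mk_eq_zero _).2 (?_ :
    chain (basePoint pt) (n + 1) z - (chain (basePoint pt) (n + 1) x +
      chain (basePoint pt) (n + 1) y) ∈ boundaries (basePoint pt) (n + 1))
  refine ⟨(-1 : ℤ) ^ (n + 1) • chain (basePoint pt) (n + 2) h, ?_⟩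
  rw [map_smul, key, smul_smul, pow_succ, mul_right_comm, ← mul_pow]
  simp only [mul_neg, mul_one, neg_neg, one_pow, neg_smul, one_smul]
  abel

lemma homologyClass_star : homologyClass (starSimplex X pt (n + 1)) (isSpherical_star n) = 0 :=
  (Submodule.Quotient.mk_eq_zero _).2 (by
    have h : chain (basePoint pt) (n + 1) (starSimplex X pt (n + 1)) ∈ boundaries (basePoint pt) (n + 1) := by
      rw [chain_star]
      exact Submodule.zero_mem _
    exact h)

/-- The Hurewicz map `[x] ↦ [x]`. -/
noncomputable def hurewiczFun [SSet.KanComplex X] :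
    HomotopyGroup X pt (n + 1) → Homology (basePoint pt) (n + 1) :=
  Quot.lift (fun x => homologyClass x.1 x.2) (by
    intro x y h
    rw [homotopic_iff x.2 y.2] at h
    rw [homologyClass_add y.2 (isSpherical_star n) x.2 h, homologyClass_star, add_zero])

/-- The Hurewicz homomorphism `πₙ(X, pt) → Hₙ(X, ⋆)`, `[x] ↦ [x]`, in the positive
degree `n + 1`. -/
noncomputable def hurewicz (X : SSet.{u}) [SSet.KanComplex X] (pt : X _⦋0⦌) (n : ℕ) :
    HomotopyGroup X pt (n + 1) →* Multiplicative (Homology (basePoint pt) (n + 1)) :=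
  MonoidHom.mk' (fun a => Multiplicative.ofAdd (hurewiczFun a)) (by
    rintro ⟨x, hx⟩ ⟨y, hy⟩
    obtain ⟨⟨z, hz⟩, h⟩ := HomotopyGroup.exists_mul ⟨x, hx⟩ ⟨y, hy⟩
    refine (congrArg (fun a => Multiplicative.ofAdd (hurewiczFun a))
      (HomotopyGroup.mk_mul_mk hx hy hz h)).trans ?_
    exact congrArg Multiplicative.ofAdd (homologyClass_add hx hy hz h))

lemma hurewicz_mk (X : SSet.{u}) [SSet.KanComplex X] (pt : X _⦋0⦌) (n : ℕ) (x : X _⦋n + 1⦌)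
    (hx : IsSpherical pt (n + 1) x) :
    hurewicz X pt n (HomotopyGroup.mk x hx) = Multiplicative.ofAdd (homologyClass x hx) :=
  rfl

end Homology

end KanHurewicz

/-!
Write `d = n + 1` for the degree under consideration. Since `K` has only one `n`-simplex, every
`d`-simplex has boundary `(⋆, …, ⋆)`, so every `d`-chain is a cycle and is a sum of classes of
spherical simplices: the Hurewicz map is surjective (`hurewicz_surjective`). For injectivity, let
`ψ` be a homomorphism from the homotopy group to a commutative group. It extends linearly to chains,
and it descends to homology as soon as it vanishes on the alternating sum of the faces of each
`(d + 1)`-simplex. This is the homotopy addition theorem (`homotopy_addition`). With `ψ` the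
projection to the abelianization one gets a left inverse in all degrees; for `d ≥ 2` the homotopy
group is commutative (`HomotopyGroup.mul_comm_of_pos`) and `ψ` may be the identity.

Both of these facts come from `matrix_lemma`, read as follows. Label the edges of the complete graph
on the vertices `0, …, d + 2` by spherical `d`-simplices. Each vertex has a row of `d + 2` labels,
and if the rows of all vertices but one are boundaries of `(d + 1)`-simplices, so is the last row.
Useful rows are those with one nontrivial label repeated in two adjacent places, which belong to
degenerate simplices.

For the homotopy addition theorem, consider relations `(⋆, …, ⋆, p, q, r, ⋆, …, ⋆)` with `p` in
place `k`. They hold in place `k` only if they hold, in reverse order, in place `k + 1`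
(`IsBoundary.shift`), and for `k = d - 1` they define the product. Moreover the first nontrivial
face of a boundary can be absorbed into the next one at the expense of such a relation
(`IsBoundary.absorb`), so downward induction on the number of leading trivial faces applies.
Commutativity is obtained by rewriting a relation `xz = y` as a boundary `(⋆, …, ⋆, y, z, ⋆, x)`,
from which absorption gives `yx⁻¹ = z`.
-/

namespace KanHurewicz

/-! ### Boundaries of simplices and labelled complete graphs -/

section Boundary

variable {X : SSet.{u}} {pt : X _⦋0⦌} {n : ℕ}

/-- Some `(n + 2)`-simplex has faces `f 0, …, f (n + 2)`. The family is indexed by `ℕ`, and its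
values beyond `n + 2` are irrelevant. -/
def IsBoundary (f : ℕ → X _⦋n + 1⦌) : Prop :=
  ∃ h : X _⦋n + 2⦌, ∀ j : Fin (n + 3), X.δ j h = f j

lemma IsBoundary.congr {f g : ℕ → X _⦋n + 1⦌} (hf : IsBoundary f) (h : ∀ j < n + 3, f j = g j) :
    IsBoundary g := by
  obtain ⟨H, hH⟩ := hf
  exact ⟨H, fun j => by rw [hH, h j j.2]⟩

/-- `matrix_lemma` for labels indexed by natural numbers: `N i j` is the label of the edge between
the vertices `i` and `j`, and the row of `i` omits the diagonal entry. -/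
lemma IsBoundary.matrix [SSet.KanComplex X] (N : ℕ → ℕ → X _⦋n + 1⦌)
    (hN : ∀ i j, N i j = N j i) {k : ℕ} (hk : k < n + 4)
    (h : ∀ i < n + 4, i ≠ k → IsBoundary fun j => N i (if j < i then j else j + 1)) :
    IsBoundary fun j => N k (if j < k then j else j + 1) := by
  obtain ⟨H, hH⟩ := matrix_lemma (fun i j : Fin (n + 4) => N i j) (fun i j => hN i j) ⟨k, hk⟩
    (fun i hi => by
      obtain ⟨H, hH⟩ := h i i.2 (fun e => hi (Fin.ext e))
      exact ⟨H, fun j => by rw [hH, succAbove_val]⟩)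
  exact ⟨H, fun j => by rw [hH, succAbove_val]⟩

lemma isBoundary_star : IsBoundary fun _ => starSimplex X pt (n + 1) :=
  ⟨starSimplex X pt (n + 2), fun j => δ_star _ j⟩

/-- The faces of the degenerate simplex `s_k x`. -/
lemma isBoundary_degenerate {x : X _⦋n + 1⦌} (hx : IsSpherical pt (n + 1) x) {k : ℕ}
    (hk : k ≤ n + 1) :
    IsBoundary fun j => if j = k ∨ j = k + 1 then x else starSimplex X pt (n + 1) := by
  refine ⟨X.σ ⟨k, by omega⟩ x, fun j => ?_⟩
  beta_reduce
  split_ifs with h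
  · rcases h with h | h
    · rw [show j = (⟨k, by omega⟩ : Fin (n + 2)).castSucc from Fin.ext h]
      exact SSet.δ_comp_σ_self_apply _ _
    · rw [show j = (⟨k, by omega⟩ : Fin (n + 2)).succ from Fin.ext h]
      exact SSet.δ_comp_σ_succ_apply _ _
  · push Not at h
    exact δ_σ_of_isSpherical hx _ _ (fun e => h.1 (congrArg Fin.val e))
      (fun e => h.2 (congrArg Fin.val e))

/-- One entry of a family of spherical simplices can be changed to make it a boundary. -/
lemma exists_isBoundary_update [SSet.KanComplex X] {f : ℕ → X _⦋n + 1⦌}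
    (hf : ∀ j, IsSpherical pt (n + 1) (f j)) {k : ℕ} (hk : k < n + 3) :
    ∃ s, IsSpherical pt (n + 1) s ∧ IsBoundary (Function.update f k s) := by
  obtain ⟨h, hh⟩ := exists_filler (⟨k, hk⟩ : Fin (n + 3)) (fun j => f j)
    (fun i j _ _ _ => by rw [hf i _, hf j _])
  refine ⟨X.δ (⟨k, hk⟩ : Fin (n + 3)) h, fun i => ?_, h, fun j => ?_⟩
  · obtain ⟨a, b, ha, hab⟩ := exists_δ_δ_eq h (⟨k, hk⟩ : Fin (n + 3)) i
    rw [hab, hh a ha, hf a b]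
  · by_cases hj : j = ⟨k, hk⟩
    · subst hj; simp
    · rw [hh j hj, Function.update_of_ne (fun e => hj (Fin.ext e))]

/-- The family `(⋆, …, ⋆, p, q, r, s, ⋆, …)`, where `p` has index `k`. -/
def quad (pt : X _⦋0⦌) (k : ℕ) (p q r s : X _⦋n + 1⦌) (j : ℕ) : X _⦋n + 1⦌ :=
  if j = k then p else if j = k + 1 then q else if j = k + 2 then r else if j = k + 3 then s
  else starSimplex X pt (n + 1)

lemma isProduct_iff_isBoundary {p q r : X _⦋n + 1⦌} :
    IsProduct pt r p q ↔ IsBoundary (quad pt n p q r (starSimplex X pt (n + 1))) := by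
  rw [isProduct_iff]
  refine exists_congr fun h => forall_congr' fun j => ?_
  have : tuple pt n p q r j = quad pt n p q r (starSimplex X pt (n + 1)) j := by
    simp only [tuple, quad]
    grind
  rw [this]

lemma quad_star_left {k : ℕ} {p q r : X _⦋n + 1⦌} :
    quad pt k (starSimplex X pt (n + 1)) p q r =
      quad pt (k + 1) p q r (starSimplex X pt (n + 1)) := by
  funext j
  simp only [quad]
  grind

/-- The symmetric matrix whose nontrivial entries have both indices in `{k, …, k + 4}`. -/
def entry₅ (pt : X _⦋0⦌) (k : ℕ) (ab ac ad ae bc bd be cd ce de : X _⦋n + 1⦌) (i j : ℕ) :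
    X _⦋n + 1⦌ :=
  if min i j = k then
    quad pt (k + 1) ab ac ad ae (max i j)
  else if min i j = k + 1 then
    quad pt (k + 2) bc bd be (starSimplex X pt (n + 1)) (max i j)
  else if min i j = k + 2 then
    quad pt (k + 3) cd ce (starSimplex X pt (n + 1)) (starSimplex X pt (n + 1)) (max i j)
  else if min i j = k + 3 then
    quad pt (k + 4) de (starSimplex X pt (n + 1)) (starSimplex X pt (n + 1))
      (starSimplex X pt (n + 1)) (max i j)
  else starSimplex X pt (n + 1)

lemma entry₅_row (k : ℕ) (ab ac ad ae bc bd be cd ce de : X _⦋n + 1⦌) (i j : ℕ) :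
    entry₅ pt k ab ac ad ae bc bd be cd ce de i (if j < i then j else j + 1) =
      if i = k then quad pt k ab ac ad ae j
      else if i = k + 1 then quad pt k ab bc bd be j
      else if i = k + 2 then quad pt k ac bc cd ce j
      else if i = k + 3 then quad pt k ad bd cd de j
      else if i = k + 4 then quad pt k ae be ce de j
      else starSimplex X pt (n + 1) := by
  by_cases h : j < i
  · simp only [entry₅, quad, if_pos h, min_eq_right h.le, max_eq_left h.le]
    grind (splits := 20)
  · have h' : i ≤ j + 1 := by omega
    simp only [entry₅, quad, if_neg h, min_eq_left h', max_eq_right h']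
    grind (splits := 20)

/-- In a complete graph on five vertices `a < b < c < d < e` with edges labelled by simplices,
let four of the vertices have boundaries as their rows of labels. Then so does the fifth. The
vertices are `k, …, k + 4`, all other labels are trivial, and `entry₅_row` computes the row of the
fifth vertex, which has index `k + l`. -/
lemma pentatope [SSet.KanComplex X] {k : ℕ} (hk : k + 1 ≤ n)
    (ab ac ad ae bc bd be cd ce de : X _⦋n + 1⦌) (l : Fin 5)
    (hA : l ≠ 0 → IsBoundary (quad pt k ab ac ad ae))
    (hB : l ≠ 1 → IsBoundary (quad pt k ab bc bd be))
    (hC : l ≠ 2 → IsBoundary (quad pt k ac bc cd ce))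
    (hD : l ≠ 3 → IsBoundary (quad pt k ad bd cd de))
    (hE : l ≠ 4 → IsBoundary (quad pt k ae be ce de)) :
    IsBoundary fun j => entry₅ pt k ab ac ad ae bc bd be cd ce de (k + l)
      (if j < k + l then j else j + 1) := by
  refine IsBoundary.matrix _ (fun i j => by simp only [entry₅, min_comm, max_comm])
    (by omega) fun i _ hi => ?_
  simp only [entry₅_row]
  by_cases h : k ≤ i ∧ i ≤ k + 4
  · obtain ⟨m, rfl⟩ := Nat.exists_eq_add_of_le h.1
    have hm : m < 5 := by omega
    have hlm : l ≠ ⟨m, hm⟩ := by rintro rfl; exact hi rfl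
    interval_cases m
    · simpa using hA hlm
    · simpa using hB hlm
    · simpa using hC hlm
    · simpa using hD hlm
    · simpa using hE hlm
  · refine (isBoundary_star (pt := pt)).congr fun j _ => ?_
    rw [if_neg, if_neg, if_neg, if_neg, if_neg] <;> omega

end Boundary

/-! ### The homotopy addition theorem -/

section Addition

variable {X : SSet.{u}} {pt : X _⦋0⦌} {n : ℕ}

lemma isBoundary_quad_left {k : ℕ} (hk : k ≤ n + 1) {x : X _⦋n + 1⦌}
    (hx : IsSpherical pt (n + 1) x) :
    IsBoundary (quad pt k x x (starSimplex X pt (n + 1)) (starSimplex X pt (n + 1))) :=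
  (isBoundary_degenerate hx hk).congr fun j _ => by simp only [quad]; grind

lemma isBoundary_quad_middle {k : ℕ} (hk : k ≤ n) {x : X _⦋n + 1⦌}
    (hx : IsSpherical pt (n + 1) x) :
    IsBoundary (quad pt k (starSimplex X pt (n + 1)) x x (starSimplex X pt (n + 1))) :=
  (isBoundary_degenerate hx (Nat.succ_le_succ hk)).congr fun j _ => by simp only [quad]; grind

lemma isBoundary_quad_right {k : ℕ} (hk : k + 1 ≤ n) {x : X _⦋n + 1⦌}
    (hx : IsSpherical pt (n + 1) x) :
    IsBoundary (quad pt k (starSimplex X pt (n + 1)) (starSimplex X pt (n + 1)) x x) :=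
  (isBoundary_degenerate hx (k := k + 2) (by omega)).congr fun j _ => by
    simp only [quad]; grind

lemma sum_quad {A : Type*} [AddCommGroup A] {k : ℕ} (hk : k ≤ n) (g : X _⦋n + 1⦌ → A)
    (hg : g (starSimplex X pt (n + 1)) = 0) (p q r : X _⦋n + 1⦌) :
    ∑ j ∈ Finset.range (n + 3), (-1 : ℤ) ^ j •
        g (quad pt k p q r (starSimplex X pt (n + 1)) j) =
      (-1 : ℤ) ^ k • (g p - g q + g r) := by
  rw [← Finset.sum_subset (s₁ := {k, k + 1, k + 2}) (by intro j; simp; omega)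
    (fun j _ hj => by
      have : quad pt k p q r (starSimplex X pt (n + 1)) j = starSimplex X pt (n + 1) := by
        simp only [quad]; grind
      rw [this, hg, smul_zero])]
  simp [quad, pow_succ]
  module

variable [SSet.KanComplex X]

/-- Moving three consecutive nontrivial faces one place to the right reverses their order. -/
lemma IsBoundary.shift {k : ℕ} (hk : k + 1 ≤ n) {p q r : X _⦋n + 1⦌}
    (hp : IsSpherical pt (n + 1) p) (hr : IsSpherical pt (n + 1) r)
    (h : IsBoundary (quad pt k p q r (starSimplex X pt (n + 1)))) :
    IsBoundary (quad pt (k + 1) r q p (starSimplex X pt (n + 1))) := by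
  -- The rows of the labelled graph are `(⋆, ⋆, p, p)`, `(⋆, r, q, p)`, `(⋆, r, r, ⋆)`,
  -- `(p, q, r, ⋆)` and `(p, p, ⋆, ⋆)`; the second one is the unknown one.
  have := pentatope hk (starSimplex X pt (n + 1)) (starSimplex X pt (n + 1)) p p r q p r
    (starSimplex X pt (n + 1)) (starSimplex X pt (n + 1)) 1
    (fun _ => isBoundary_quad_right hk hp) (fun h => absurd rfl h)
    (fun _ => isBoundary_quad_middle (by omega) hr) (fun _ => h)
    (fun _ => isBoundary_quad_left (by omega) hp)
  rw [← quad_star_left]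
  exact this.congr fun j _ => by rw [entry₅_row]; simp

/-- Let `f` be a boundary whose entries below `s` are trivial. The nontrivial entry `f s` can be
absorbed into its successor. -/
lemma IsBoundary.absorb {s : ℕ} (hs : s + 1 ≤ n) {f : ℕ → X _⦋n + 1⦌}
    (hsph : ∀ j, IsSpherical pt (n + 1) (f j)) (hf : IsBoundary f)
    (h0 : ∀ j < s, f j = starSimplex X pt (n + 1)) {q : X _⦋n + 1⦌}
    (hq : IsBoundary (quad pt s (f s) (f (s + 1)) q (starSimplex X pt (n + 1)))) :
    IsBoundary fun j => if j = s then starSimplex X pt (n + 1) else if j = s + 1 then q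
      else f j := by
  -- The rows of indices `s + 2` and `s + 3` are the old and the new family. Those of larger
  -- index contain two equal adjacent entries.
  let U (a b : ℕ) : X _⦋n + 1⦌ :=
    if a = s then (if b = s + 1 ∨ b = s + 2 then f s else starSimplex X pt (n + 1))
    else if a = s + 1 then
      (if b = s + 2 then f (s + 1) else if b = s + 3 then q else starSimplex X pt (n + 1))
    else if a = s + 2 ∨ a = s + 3 then f (b - 1)
    else starSimplex X pt (n + 1)
  have key := IsBoundary.matrix (n := n) (fun i j => U (min i j) (max i j))
    (fun i j => by simp only [min_comm, max_comm]) (k := s + 3) (by omega) (fun i hi hne => by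
      rcases lt_or_ge i s with h | h
      · refine (isBoundary_star (pt := pt)).congr fun j _ => ?_
        by_cases hj : j < i
        · simp only [U, if_pos hj, min_eq_right hj.le, max_eq_left hj.le]
          grind
        · have hj' : i ≤ j + 1 := by omega
          simp only [U, if_neg hj, min_eq_left hj', max_eq_right hj']
          grind
      · have hrow (g : ℕ → X _⦋n + 1⦌) (hg : IsBoundary g)
            (h1 : ∀ j < i, g j = U j i) (h2 : ∀ j, i ≤ j → g j = U i (j + 1)) :
            IsBoundary fun j => U (min i (if j < i then j else j + 1))
              (max i (if j < i then j else j + 1)) := by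
          refine hg.congr fun j _ => ?_
          by_cases hj : j < i
          · rw [if_pos hj, min_eq_right hj.le, max_eq_left hj.le, h1 j hj]
          · have hj' : i ≤ j + 1 := by omega
            rw [if_neg hj, min_eq_left hj', max_eq_right hj', h2 j (by omega)]
        by_cases e0 : i = s
        · exact hrow _ (isBoundary_degenerate (hsph s) (k := s) (by omega))
            (by grind) (by grind)
        by_cases e1 : i = s + 1
        · exact hrow _ hq (by simp only [quad]; grind) (by simp only [quad]; grind)
        by_cases e2 : i = s + 2
        · exact hrow _ hf (by grind) (by grind)
        · exact hrow _ (isBoundary_degenerate (hsph (i - 1)) (k := s + 2) (by omega))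
            (by grind) (by grind))
  refine key.congr fun j _ => ?_
  by_cases hj : j < s + 3
  · simp only [U, if_pos hj, min_eq_right hj.le, max_eq_left hj.le]
    grind
  · have hj' : s + 3 ≤ j + 1 := by omega
    simp only [U, if_neg hj, min_eq_left hj', max_eq_right hj']
    grind

/-- The homotopy addition theorem: a function with values in a commutative group which is additive
on products vanishes on the alternating sum of the faces of a simplex with spherical faces. -/
theorem homotopy_addition {A : Type*} [AddCommGroup A] (g : X _⦋n + 1⦌ → A)
    (hg : ∀ p q r, IsSpherical pt (n + 1) p → IsSpherical pt (n + 1) q →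
      IsSpherical pt (n + 1) r → IsProduct pt r p q → g q = g r + g p)
    {f : ℕ → X _⦋n + 1⦌} (hsph : ∀ j, IsSpherical pt (n + 1) (f j)) (hf : IsBoundary f) :
    ∑ j ∈ Finset.range (n + 3), (-1 : ℤ) ^ j • g (f j) = 0 := by
  have hstar : IsSpherical pt (n + 1) (starSimplex X pt (n + 1)) := isSpherical_star n
  have hg0 : g (starSimplex X pt (n + 1)) = 0 := by
    simpa using hg _ _ _ hstar hstar hstar star_star
  -- Downward induction on a number `s` of leading trivial faces.
  suffices H : ∀ s ≤ n, ∀ f : ℕ → X _⦋n + 1⦌, (∀ j, IsSpherical pt (n + 1) (f j)) →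
      IsBoundary f → (∀ j < s, f j = starSimplex X pt (n + 1)) →
      ∑ j ∈ Finset.range (n + 3), (-1 : ℤ) ^ j • g (f j) = 0 from
    H 0 (Nat.zero_le n) f hsph hf (by simp)
  intro s hs
  induction hs using Nat.decreasingInduction with
  | self =>
    intro f hsph hf h0
    have e (j : ℕ) (hj : j < n + 3) :
        f j = quad pt n (f n) (f (n + 1)) (f (n + 2)) (starSimplex X pt (n + 1)) j := by
      simp only [quad]
      grind
    have h := hg _ _ _ (hsph n) (hsph (n + 1)) (hsph (n + 2))
      (isProduct_iff_isBoundary.2 (hf.congr e))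
    rw [Finset.sum_congr rfl fun j hj => by rw [e j (Finset.mem_range.1 hj)],
      sum_quad le_rfl g hg0, h]
    simp
  | of_succ s hs' IH =>
    intro f hsph hf h0
    -- The relation between `f s`, `f (s + 1)` and `q` is shifted by one place, where the induction
    -- hypothesis turns it into an identity between values of `g`.
    obtain ⟨q, hq, hb⟩ := exists_isBoundary_update (pt := pt) (n := n) (k := s + 2)
      (f := quad pt s (f s) (f (s + 1)) (starSimplex X pt (n + 1)) (starSimplex X pt (n + 1)))
      (fun j => by simp only [quad]; split_ifs <;> first | assumption | exact hsph _)
      (by omega)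
    replace hb : IsBoundary (quad pt s (f s) (f (s + 1)) q (starSimplex X pt (n + 1))) :=
      hb.congr fun j _ => by simp only [quad, Function.update_apply]; grind
    have h1 := IH (quad pt (s + 1) q (f (s + 1)) (f s) (starSimplex X pt (n + 1)))
      (fun j => by simp only [quad]; split_ifs <;> first | assumption | exact hsph _)
      (hb.shift hs' (hsph s) hq) (fun j hj => by simp only [quad]; grind)
    rw [sum_quad hs' g hg0] at h1
    have h2 := IH _ (fun j => by split_ifs <;> first | assumption | exact hsph _)
      (hf.absorb hs' hsph h0 hb) (fun j hj => by
        rcases Nat.lt_succ_iff_lt_or_eq.1 hj with hj | rfl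
        · rw [if_neg (by omega), if_neg (by omega), h0 j hj]
        · rw [if_pos rfl])
    rw [← h2, ← sub_eq_zero, ← Finset.sum_sub_distrib,
      ← Finset.sum_subset (s₁ := {s, s + 1}) (by intro j; simp; omega)
        (fun j _ hj => by
          simp only [Finset.mem_insert, Finset.mem_singleton, not_or] at hj
          rw [if_neg hj.1, if_neg hj.2, sub_self]),
      Finset.sum_pair (by omega), ← neg_eq_zero, ← h1]
    simp [pow_succ, hg0]
    module

end Addition

/-! ### Commutativity of the higher homotopy groups -/

namespace HomotopyGroup

variable {X : SSet.{u}} [SSet.KanComplex X] {pt : X _⦋0⦌} {n : ℕ}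

lemma mul_comm_of_pos (hn : 1 ≤ n) (a b : HomotopyGroup X pt (n + 1)) : a * b = b * a := by
  obtain ⟨k, rfl⟩ := Nat.exists_eq_add_of_le' hn
  obtain ⟨x, hx⟩ := a
  obtain ⟨z, hz⟩ := b
  obtain ⟨⟨y, hy⟩, h⟩ := exists_mul ⟨x, hx⟩ ⟨z, hz⟩
  -- The rows of the labelled graph are `(⋆, y, y, ⋆)`, `(⋆, z, y, x)`, `(y, z, ⋆, x)`,
  -- `(y, y, ⋆, ⋆)` and `(⋆, x, x, ⋆)`.
  have h1 : IsBoundary (quad pt k y z (starSimplex X pt (k + 1 + 1)) x) := by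
    rw [isProduct_iff_isBoundary, ← quad_star_left] at h
    refine (pentatope le_rfl (starSimplex X pt (k + 1 + 1)) y y (starSimplex X pt (k + 1 + 1)) z y x
      (starSimplex X pt (k + 1 + 1)) x (starSimplex X pt (k + 1 + 1)) 2
      (fun _ => isBoundary_quad_middle (by omega) hy) (fun _ => h) (fun h => absurd rfl h)
      (fun _ => isBoundary_quad_left (by omega) hy)
      (fun _ => isBoundary_quad_middle (by omega) hx)).congr fun j _ => ?_
    rw [entry₅_row]; simp
  have hstar : IsSpherical pt (k + 1 + 1) (starSimplex X pt (k + 1 + 1)) := isSpherical_star _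
  -- Choose `q` so that `(y, z, q, ⋆)` is a boundary. Shifting it gives `[y] * [q] = [z]`, and
  -- absorbing `y` in `(y, z, ⋆, x)` gives `[x] * [q] = 1`.
  obtain ⟨q, hq, hb⟩ := exists_isBoundary_update (pt := pt) (n := k + 1) (k := k + 2)
    (f := quad pt k y z (starSimplex X pt (k + 1 + 1)) (starSimplex X pt (k + 1 + 1)))
    (fun j => by simp only [quad]; split_ifs <;> assumption) (by omega)
  replace hb : IsBoundary (quad pt k y z q (starSimplex X pt (k + 1 + 1))) :=
    hb.congr fun j _ => by simp only [quad, Function.update_apply]; grind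
  have h2 : mk y hy * mk q hq = mk z hz :=
    mk_mul_mk hy hq hz (isProduct_iff_isBoundary.2 (hb.shift le_rfl hy hq))
  have h3 : mk x hx * mk q hq = 1 :=
    mk_mul_mk hx hq hstar (isProduct_iff_isBoundary.2
      ((h1.absorb (s := k) le_rfl (fun j => by simp only [quad]; split_ifs <;> assumption)
        (fun j hj => by simp only [quad]; grind) (q := q)
        (hb.congr fun j _ => by simp only [quad]; grind)).congr
          fun j _ => by simp only [quad]; grind))
  change mk x hx * mk z hz = mk z hz * mk x hx
  rw [mk_mul_mk hx hz hy h, ← h2, eq_inv_of_mul_eq_one_right h3, inv_mul_cancel_right]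

end HomotopyGroup

/-! ### The Hurewicz isomorphism -/

section Hurewicz

variable {X : SSet.{u}} {pt : X _⦋0⦌} {n : ℕ}

lemma isSpherical_of_forall_eq (hX : ∀ y : X _⦋n⦌, y = starSimplex X pt n) (x : X _⦋n + 1⦌) :
    IsSpherical pt (n + 1) x :=
  fun _ => hX _

variable [SSet.KanComplex X]

lemma hurewicz_surjective (hX : ∀ y : X _⦋n⦌, y = starSimplex X pt n) :
    Function.Surjective (hurewicz X pt n) := by
  rw [← MonoidHom.range_eq_top, eq_top_iff]
  rintro a -
  -- Every chain is a cycle, hence a sum of spherical simplices.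
  have hcyc (c : Chains (basePoint pt) (n + 1)) : c ∈ cycles (basePoint pt) (n + 1) := by
    obtain ⟨c, rfl⟩ := Submodule.Quotient.mk_surjective _ c
    induction c using Finsupp.induction_linear with
    | zero => exact Submodule.zero_mem _
    | add c c' h h' => exact Submodule.add_mem _ h h'
    | single x m =>
      have : Finsupp.single x m = m • Finsupp.single x (1 : ℤ) := by simp
      rw [this]
      exact Submodule.smul_mem _ m (chain_mem_cycles (isSpherical_of_forall_eq hX x))
  have key (c : X _⦋n + 1⦌ →₀ ℤ) : Multiplicative.ofAdd (Submodule.Quotient.mk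
      ⟨Submodule.Quotient.mk c, hcyc _⟩ : Homology (basePoint pt) (n + 1)) ∈
      (hurewicz X pt n).range := by
    induction c using Finsupp.induction_linear with
    | zero => exact Subgroup.one_mem _
    | add c c' h h' => exact Subgroup.mul_mem _ h h'
    | single x m =>
      have : Finsupp.single x m = m • Finsupp.single x (1 : ℤ) := by simp
      have hx : Multiplicative.ofAdd (homologyClass x (isSpherical_of_forall_eq hX x)) ∈
          (hurewicz X pt n).range := ⟨HomotopyGroup.mk x _, hurewicz_mk ..⟩
      simp only [this]
      exact Subgroup.zpow_mem _ hx m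
  obtain ⟨⟨c, hc⟩, rfl⟩ := Submodule.Quotient.mk_surjective _ a.toAdd
  obtain ⟨c, rfl⟩ := Submodule.Quotient.mk_surjective _ c
  exact key c

/-- A homomorphism from the homotopy group to a commutative group factors through the Hurewicz
homomorphism: by the homotopy addition theorem, its values on simplices kill the boundaries. -/
lemma exists_comp_hurewicz (hX : ∀ y : X _⦋n⦌, y = starSimplex X pt n) {A : Type*} [CommGroup A]
    (ψ : HomotopyGroup X pt (n + 1) →* A) :
    ∃ Φ : Multiplicative (Homology (basePoint pt) (n + 1)) →* A, Φ.comp (hurewicz X pt n) = ψ := by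
  have hsph := isSpherical_of_forall_eq hX
  let g (x : X _⦋n + 1⦌) : Additive A := Additive.ofMul (ψ (HomotopyGroup.mk x (hsph x)))
  have hg (p q r) (hp : IsSpherical pt (n + 1) p) (hq : IsSpherical pt (n + 1) q)
      (hr : IsSpherical pt (n + 1) r) (h : IsProduct pt r p q) : g q = g r + g p := by
    simp only [g, ← HomotopyGroup.mk_mul_mk hr hp hq h, map_mul, ofMul_mul]
  have hg0 : g (starSimplex X pt (n + 1)) = 0 := by
    simpa using hg _ _ _ (isSpherical_star n) (isSpherical_star n) (isSpherical_star n) star_star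
  let G : (X _⦋n + 1⦌ →₀ ℤ) →ₗ[ℤ] Additive A := Finsupp.linearCombination ℤ g
  have hG : Finsupp.supported ℤ ℤ ((basePoint pt).obj (op ⦋n + 1⦌)) ≤ LinearMap.ker G := by
    rw [Finsupp.supported_eq_span_single, Submodule.span_le]
    rintro _ ⟨x, hx, rfl⟩
    obtain ⟨f, rfl⟩ := (SSet.Subcomplex.mem_ofSimplex_obj_iff _ _).1 hx
    have hf : X.map f.op pt = starSimplex X pt (n + 1) := by
      rw [starSimplex, Subsingleton.elim f (SimplexCategory.const ⦋n + 1⦌ ⦋0⦌ 0)]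
    simp [G, hf, hg0]
  let G' : Chains (basePoint pt) (n + 1) →ₗ[ℤ] Additive A := Submodule.liftQ _ G hG
  have hd : G' ∘ₗ differential (basePoint pt) (n + 1) = 0 := by
    ext x
    have h := homotopy_addition g hg
      (f := fun j => if h : j < n + 3 then X.δ (⟨j, h⟩ : Fin (n + 3)) x
        else starSimplex X pt (n + 1)) (fun j => hsph _) ⟨x, fun j => by simp⟩
    rw [Finset.sum_range] at h
    have hchain (y : X _⦋n + 1⦌) : G' (chain (basePoint pt) (n + 1) y) = g y := by
      simp [G', G, chain]
    change G' (differential (basePoint pt) (n + 1) (chain (basePoint pt) (n + 2) x)) = 0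
    rw [differential_chain, map_sum, ← h]
    exact Finset.sum_congr rfl fun j _ => by simp [hchain]
  have hG' : (boundaries (basePoint pt) (n + 1)).submoduleOf (cycles (basePoint pt) (n + 1)) ≤
      LinearMap.ker (G'.domRestrict (cycles (basePoint pt) (n + 1))) := by
    rintro ⟨_, _⟩ ⟨c, rfl⟩
    exact LinearMap.congr_fun hd c
  let H : Homology (basePoint pt) (n + 1) →ₗ[ℤ] Additive A := Submodule.liftQ _ _ hG'
  refine ⟨AddMonoidHom.toMultiplicativeLeft H.toAddMonoidHom, ?_⟩
  ext ⟨x, hx⟩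
  have h : G (Finsupp.single x 1) = g x := by simp [G]
  exact congrArg Additive.toMul h

/-- The Hurewicz isomorphism, in a form which covers all positive degrees. -/
theorem bijective_abelianization_lift_hurewicz (hX : ∀ y : X _⦋n⦌, y = starSimplex X pt n) :
    Function.Bijective (Abelianization.lift (hurewicz X pt n)) := by
  refine ⟨?_, fun a => ?_⟩
  · obtain ⟨Φ, hΦ⟩ := exists_comp_hurewicz hX Abelianization.of
    have : Φ.comp (Abelianization.lift (hurewicz X pt n)) = MonoidHom.id _ := by
      ext a
      simpa using DFunLike.congr_fun hΦ a
    exact Function.LeftInverse.injective (DFunLike.congr_fun this)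
  · obtain ⟨b, rfl⟩ := hurewicz_surjective hX a
    exact ⟨Abelianization.of b, Abelianization.lift_apply_of ..⟩

end Hurewicz
end KanHurewicz

theorem mainTheorem5 (K : SSet.{u}) [SSet.KanComplex K] (pt : K _⦋0⦌) :
    (∀ n : ℕ, 2 ≤ n + 1 → (∀ y : K _⦋n⦌, y = KanHurewicz.starSimplex K pt n) →
      Function.Bijective (KanHurewicz.hurewicz K pt n :
        KanHurewicz.HomotopyGroup K pt (n + 1) →*
          Multiplicative (KanHurewicz.Homology (KanHurewicz.basePoint pt) (n + 1)))) ∧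
    ((∀ y : K _⦋0⦌, y = pt) →
      Function.Bijective (Abelianization.lift (KanHurewicz.hurewicz K pt 0) :
        Abelianization (KanHurewicz.HomotopyGroup K pt 1) →*
          Multiplicative (KanHurewicz.Homology (KanHurewicz.basePoint pt) 1))) := by
  refine ⟨fun n hn hK => ⟨?_, KanHurewicz.hurewicz_surjective hK⟩, fun hK =>
    KanHurewicz.bijective_abelianization_lift_hurewicz fun y =>
      (hK y).trans (hK (KanHurewicz.starSimplex K pt 0)).symm⟩
  let _ : CommGroup (KanHurewicz.HomotopyGroup K pt (n + 1)) :=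
    { mul_comm := KanHurewicz.HomotopyGroup.mul_comm_of_pos (Nat.le_of_succ_le_succ hn) }
  obtain ⟨Φ, hΦ⟩ := KanHurewicz.exists_comp_hurewicz hK
    (MonoidHom.id (KanHurewicz.HomotopyGroup K pt (n + 1)))
  exact Function.LeftInverse.injective (DFunLike.congr_fun hΦ)
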